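/- For integers $m\ge 1$ and $d\ge 1$, a randomized decision tree of depth $d$ on $m$ bits is a probability distribution over deterministic decision trees that query bits of an input $x\in\{\pm1\}^m$ adaptively, make at most $d$ queries on every path, and accept or reject at each leaf; its acceptance probability function $f:\{\pm1\}^m\to[0,1]$ sends $x$ to the probability that a tree drawn from this distribution accepts $x$. For $\mu\in(-1,1)^m$ let $p_\mu$ be the product distribution on $\{\pm1\}^m$ whose independent coordinates satisfy $\Pr[X_i=1]=(1+\mu_i)/2$ and $\Pr[X_i=-1]=(1-\mu_i)/2$, and for $S\subseteq\{1,\dots,m\}$ and $\ell\ge 0$ put $$\phi^\mu_S(x)=\prod_{i\in S}\frac{x_i-\mu_i}{\sqrt{1-\mu_i^2}},\qquad \hat f^\mu(S)=\mathbb{E}_{X\sim p_\mu}\big[f(X)\,\phi^\mu_S(X)\big],\qquad \mathsf{wt}^\mu_\ell(f)=\sum_{|S|=\ell}\big|\hat f^\mu(S)\big| .$$ Corollary. There is a universal constant $c>0$ such that the following holds for all integers $m\ge1$ and $1\le \ell\le d$. If $f:\{\pm1\}^m\to[0,1]$ is the acceptance probability function of a randomized decision tree of depth $d$, then for every $\mu\in[-\tfrac12,\tfrac12]^m$,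 $$\mathsf{wt}^\mu_\ell(f)\le\Big((cd)^\ell\,(\log m)^{\ell-1}\Big)^{1/2},$$ where $\log$ is the natural logarithm and $(\log m)^0=1$. -/

import Mathlib

/-- A deterministic decision tree on `m` bits: a leaf accepts or rejects, an inner node queries
the bit `i` and continues in `neg` if that bit is `-1` and in `pos` if it is `1`. -/
inductive DecisionTree (m : ℕ) : Type where
  | leaf (accept : Bool) : DecisionTree m
  | query (i : Fin m) (neg pos : DecisionTree m) : DecisionTree m

namespace DecisionTree

/-- The largest number of queries on a path from the root to a leaf. -/
def depth {m : ℕ} : DecisionTree m → ℕ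
  | leaf _ => 0
  | query _ neg pos => max neg.depth pos.depth + 1

/-- The answer of the tree on an input in `{±1}^m` (the units of `ℤ` are `1` and `-1`);
`true` means that the input is accepted. -/
def eval {m : ℕ} : DecisionTree m → (Fin m → ℤˣ) → Bool
  | leaf b, _ => b
  | query i neg pos, x => if x i = 1 then pos.eval x else neg.eval x

end DecisionTree

/-- A randomized decision tree of depth `d` on `m` bits: a probability distribution over
deterministic decision trees that make at most `d` queries. -/
structure RandomizedDecisionTree (m d : ℕ) where
  law : PMF (DecisionTree m)
  depth_le : ∀ T ∈ law.support, T.depth ≤ d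

/-- The probability that a randomized decision tree accepts the input `x`. -/
noncomputable def RandomizedDecisionTree.acceptProb {m d : ℕ} (R : RandomizedDecisionTree m d)
    (x : Fin m → ℤˣ) : ℝ :=
  (R.law.toOuterMeasure {T | T.eval x = true}).toReal

/-- The mass of the point `x` under the product distribution `p_μ` on `{±1}^m`, whose independent
coordinates are `1` with probability `(1 + μ i) / 2` and `-1` with probability `(1 - μ i) / 2`. -/
noncomputable def biasedMass {m : ℕ} (μ : Fin m → ℝ) (x : Fin m → ℤˣ) : ℝ :=
  ∏ i, if x i = 1 then (1 + μ i) / 2 else (1 - μ i) / 2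

/-- The biased character `φ_S^μ(x) = ∏_{i ∈ S} (x_i - μ_i) / σ_i` with `σ_i = √(1 - μ_i²)`. -/
noncomputable def biasedCharacter {m : ℕ} (μ : Fin m → ℝ) (S : Finset (Fin m))
    (x : Fin m → ℤˣ) : ℝ :=
  ∏ i ∈ S, (((x i : ℤ) : ℝ) - μ i) / Real.sqrt (1 - μ i ^ 2)

/-- The Fourier coefficient of `f` at `S` with respect to `p_μ`, that is `E_{p_μ}[f φ_S^μ]`. -/
noncomputable def biasedFourierCoeff {m : ℕ} (μ : Fin m → ℝ) (f : (Fin m → ℤˣ) → ℝ)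
    (S : Finset (Fin m)) : ℝ :=
  ∑ x : Fin m → ℤˣ, biasedMass μ x * (f x * biasedCharacter μ S x)

/-- The level-`l` Fourier weight of `f` with respect to `p_μ`. -/
noncomputable def biasedFourierWeight {m : ℕ} (μ : Fin m → ℝ) (l : ℕ)
    (f : (Fin m → ℤˣ) → ℝ) : ℝ :=
  ∑ S ∈ Finset.powersetCard l (Finset.univ : Finset (Fin m)), |biasedFourierCoeff μ f S|

/-! By duality it suffices to bound a sum of coefficients weighted by numbers `a S` of modulus at
most 1. Under the uniform distribution, monomials containing an unqueried variable average out, so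
the sum is at most the mean of |M_d|, where M_t is the polynomial ∑ a_S x^S restricted to the first
t queried variables.

M_t is a martingale; its increment is the new bit times a polynomial of the same kind of one degree
less. A two-point inequality gives ‖M_{t+1}‖² ≤ ‖M_t‖² + 2k‖increment‖² in L^{2k}
(`sum_queriedSum_pow_le`). The new variable depends on the input, so the increment is bounded by a
sum over all m variables, which costs m^{1/k} ≤ e for k ≈ log m. By induction each degree costs a
factor 2ked; the top degree needs only L², which saves one logarithm (`sum_abs_queriedSum_le`).

For biased distributions, a random restriction expresses the coefficients as averages of uniform
coefficients of restricted trees (`card_mul_biasedFourierCoeff`). Randomized trees follow by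
linearity. -/

namespace DecisionTree

variable {m : ℕ}

/-! ### Runs of a decision tree and flips of a single answer -/

/-- The subtree that is reached by following the answer to the query at the root. -/
def step (x : Fin m → ℤˣ) : DecisionTree m → DecisionTree m
  | leaf b => leaf b
  | query i neg pos => if x i = 1 then pos else neg

/-- The variable queried at the root, as a set with at most one element. -/
def root : DecisionTree m → Finset (Fin m)
  | leaf _ => ∅
  | query i _ _ => {i}

/-- The subtree that is reached on input `x` after `t` queries. -/
def after (T : DecisionTree m) (x : Fin m → ℤˣ) : ℕ → DecisionTree m
  | 0 => T
  | t + 1 => (T.after x t).step x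

/-- The variables among the first `t` queries on input `x`. -/
def queried (T : DecisionTree m) (x : Fin m → ℤˣ) : ℕ → Finset (Fin m)
  | 0 => ∅
  | t + 1 => (T.after x t).root ∪ T.queried x t

/-- The variable of query number `t + 1` if it was not queried before. -/
def fresh (T : DecisionTree m) (x : Fin m → ℤˣ) (t : ℕ) : Finset (Fin m) :=
  (T.after x t).root \ T.queried x t

theorem step_congr (T : DecisionTree m) {x y : Fin m → ℤˣ} (h : ∀ i ∈ T.root, y i = x i) :
    T.step y = T.step x := by
  cases T with
  | leaf b => rfl
  | query i neg pos => simp [step, h i (by simp [root])]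

/-- A run depends only on the answers it has read. -/
theorem after_queried_congr (T : DecisionTree m) {x y : Fin m → ℤˣ} {t : ℕ}
    (h : ∀ i ∈ T.queried x t, y i = x i) :
    T.after y t = T.after x t ∧ T.queried y t = T.queried x t := by
  induction t with
  | zero => exact ⟨rfl, rfl⟩
  | succ t ih =>
    obtain ⟨h1, h2⟩ := ih fun i hi => h i (Finset.mem_union_right _ hi)
    refine ⟨?_, by simp only [queried, h1, h2]⟩
    simp only [after, h1]
    exact step_congr _ fun i hi => h i (Finset.mem_union_left _ hi)

theorem eval_step (T : DecisionTree m) (x : Fin m → ℤˣ) : (T.step x).eval x = T.eval x := by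
  cases T with
  | leaf b => rfl
  | query i neg pos => by_cases h : x i = 1 <;> simp [step, eval, h]

theorem depth_step (T : DecisionTree m) (x : Fin m → ℤˣ) : (T.step x).depth ≤ T.depth - 1 := by
  cases T with
  | leaf b => simp [step, depth]
  | query i neg pos => by_cases h : x i = 1 <;> simp [step, depth, h]

theorem eval_after (T : DecisionTree m) (x : Fin m → ℤˣ) (t : ℕ) :
    (T.after x t).eval x = T.eval x := by
  induction t with
  | zero => rfl
  | succ t ih => rw [after, eval_step, ih]

theorem depth_after (T : DecisionTree m) (x : Fin m → ℤˣ) (t : ℕ) :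
    (T.after x t).depth ≤ T.depth - t := by
  induction t with
  | zero => rfl
  | succ t ih =>
    have := depth_step (T.after x t) x
    rw [after]
    omega

theorem eval_congr_of_depth_eq_zero (T : DecisionTree m) (h : T.depth = 0)
    (x y : Fin m → ℤˣ) : T.eval y = T.eval x := by
  cases T with
  | leaf b => rfl
  | query i neg pos => simp [depth] at h

theorem eval_congr (T : DecisionTree m) {x y : Fin m → ℤˣ} {d : ℕ} (hd : T.depth ≤ d)
    (h : ∀ i ∈ T.queried x d, y i = x i) : T.eval y = T.eval x := by
  rw [← T.eval_after x d, ← T.eval_after y d, (T.after_queried_congr h).1]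
  refine eval_congr_of_depth_eq_zero _ ?_ x y
  have := T.depth_after x d
  omega

theorem card_root_le_one (T : DecisionTree m) : T.root.card ≤ 1 := by
  cases T <;> simp [root]

theorem card_fresh_le_one (T : DecisionTree m) (x : Fin m → ℤˣ) (t : ℕ) :
    (T.fresh x t).card ≤ 1 :=
  (Finset.card_le_card Finset.sdiff_subset).trans (card_root_le_one _)

theorem queried_succ (T : DecisionTree m) (x : Fin m → ℤˣ) (t : ℕ) :
    T.queried x (t + 1) = T.fresh x t ∪ T.queried x t := by
  rw [queried, fresh, Finset.sdiff_union_self_eq_union]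

theorem not_mem_queried_of_mem_fresh {T : DecisionTree m} {x : Fin m → ℤˣ} {t : ℕ} {i : Fin m}
    (h : i ∈ T.fresh x t) : i ∉ T.queried x t :=
  (Finset.mem_sdiff.1 h).2

/-- The input `x` with the answer to query number `t + 1` flipped if that query is fresh. -/
def flip (T : DecisionTree m) (t : ℕ) (x : Fin m → ℤˣ) : Fin m → ℤˣ :=
  fun i => if i ∈ T.fresh x t then -x i else x i

theorem flip_apply_of_mem_queried {T : DecisionTree m} {x : Fin m → ℤˣ} {t : ℕ} {i : Fin m}
    (h : i ∈ T.queried x t) : T.flip t x i = x i :=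
  if_neg fun h' => not_mem_queried_of_mem_fresh h' h

theorem queried_flip (T : DecisionTree m) (t : ℕ) (x : Fin m → ℤˣ) :
    T.queried (T.flip t x) t = T.queried x t :=
  (T.after_queried_congr fun _ => flip_apply_of_mem_queried).2

theorem fresh_flip (T : DecisionTree m) (t : ℕ) (x : Fin m → ℤˣ) :
    T.fresh (T.flip t x) t = T.fresh x t := by
  obtain ⟨h1, h2⟩ := T.after_queried_congr (x := x) (y := T.flip t x) (t := t)
    fun _ => flip_apply_of_mem_queried
  rw [fresh, fresh, h1, h2]

theorem flip_involutive (T : DecisionTree m) (t : ℕ) : Function.Involutive (T.flip t) := by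
  intro x
  funext i
  have h : T.flip t (T.flip t x) i
      = if i ∈ T.fresh (T.flip t x) t then -T.flip t x i else T.flip t x i := rfl
  rw [h, fresh_flip, flip]
  by_cases hi : i ∈ T.fresh x t <;> simp [hi]

/-! ### The martingale of queried monomials -/

/-- The homogeneous polynomial of degree `l` with coefficients `a`, restricted to the variables
among the first `t` queries on input `x`. -/
noncomputable def queriedSum (T : DecisionTree m) (a : Finset (Fin m) → ℝ) (l t : ℕ)
    (x : Fin m → ℤˣ) : ℝ :=
  ∑ S ∈ (T.queried x t).powersetCard l, a S * ∏ i ∈ S, ((x i : ℤ) : ℝ)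

/-- The increment of `queriedSum` of degree `l + 1` at query number `t + 1`. -/
noncomputable def queriedIncr (T : DecisionTree m) (a : Finset (Fin m) → ℝ) (l t : ℕ)
    (x : Fin m → ℤˣ) : ℝ :=
  ∑ i ∈ T.fresh x t, ((x i : ℤ) : ℝ) * T.queriedSum (fun S => a (insert i S)) l t x

theorem queriedSum_zero_left (T : DecisionTree m) (a : Finset (Fin m) → ℝ) (t : ℕ)
    (x : Fin m → ℤˣ) : T.queriedSum a 0 t x = a ∅ := by
  simp [queriedSum]

theorem queriedSum_zero_right (T : DecisionTree m) (a : Finset (Fin m) → ℝ) (l : ℕ)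
    (x : Fin m → ℤˣ) : T.queriedSum a (l + 1) 0 x = 0 := by
  rw [queriedSum, queried, Finset.powersetCard_eq_empty.2 (by simp), Finset.sum_empty]

theorem queriedSum_succ (T : DecisionTree m) (a : Finset (Fin m) → ℝ) (l t : ℕ)
    (x : Fin m → ℤˣ) :
    T.queriedSum a (l + 1) (t + 1) x = T.queriedSum a (l + 1) t x + T.queriedIncr a l t x := by
  rcases Nat.le_one_iff_eq_zero_or_eq_one.1 (T.card_fresh_le_one x t) with h | h
  · rw [queriedIncr, queriedSum, queriedSum, queried_succ, Finset.card_eq_zero.1 h]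
    simp
  · obtain ⟨i, hi⟩ := Finset.card_eq_one.1 h
    have hq : i ∉ T.queried x t := not_mem_queried_of_mem_fresh (hi ▸ Finset.mem_singleton_self i)
    rw [queriedIncr, hi, Finset.sum_singleton, queriedSum, queriedSum, queriedSum, queried_succ,
      hi, Finset.singleton_union, Finset.powersetCard_succ_insert hq, Finset.sum_union,
      Finset.sum_image]
    · rw [Finset.mul_sum]
      congr 1
      refine Finset.sum_congr rfl fun S hS => ?_
      rw [Finset.prod_insert fun h' => hq ((Finset.mem_powersetCard.1 hS).1 h')]
      ring
    · intro S hS S' hS' h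
      have hS := fun h' => hq ((Finset.mem_powersetCard.1 hS).1 h')
      have hS' := fun h' => hq ((Finset.mem_powersetCard.1 hS').1 h')
      rw [← Finset.erase_insert hS, h, Finset.erase_insert hS']
    · refine Finset.disjoint_left.2 fun S hS hS' => ?_
      obtain ⟨S', -, rfl⟩ := Finset.mem_image.1 hS'
      exact hq ((Finset.mem_powersetCard.1 hS).1 (Finset.mem_insert_self i S'))

theorem queriedSum_flip (T : DecisionTree m) (a : Finset (Fin m) → ℝ) (l t : ℕ)
    (x : Fin m → ℤˣ) : T.queriedSum a l t (T.flip t x) = T.queriedSum a l t x := by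
  rw [queriedSum, queriedSum, queried_flip]
  refine Finset.sum_congr rfl fun S hS => ?_
  congr 1
  refine Finset.prod_congr rfl fun i hi => ?_
  rw [flip_apply_of_mem_queried ((Finset.mem_powersetCard.1 hS).1 hi)]

/-- With `queriedSum_flip` this replaces the martingale property: flipping a fresh answer preserves
the uniform measure and the past, but negates the increment. -/
theorem queriedIncr_flip (T : DecisionTree m) (a : Finset (Fin m) → ℝ) (l t : ℕ)
    (x : Fin m → ℤˣ) : T.queriedIncr a l t (T.flip t x) = -T.queriedIncr a l t x := by
  rw [queriedIncr, queriedIncr, fresh_flip, ← Finset.sum_neg_distrib]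
  refine Finset.sum_congr rfl fun i hi => ?_
  rw [queriedSum_flip, flip, if_pos hi]
  simp

/-- The fresh variable varies with `x`; summing over all variables removes this dependence. -/
theorem queriedIncr_pow_le (T : DecisionTree m) (a : Finset (Fin m) → ℝ) (l t : ℕ) {k : ℕ}
    (hk : k ≠ 0) (x : Fin m → ℤˣ) :
    T.queriedIncr a l t x ^ (2 * k)
      ≤ ∑ i, T.queriedSum (fun S => a (insert i S)) l t x ^ (2 * k) := by
  have h0 : ∀ i ∈ Finset.univ, 0 ≤ T.queriedSum (fun S => a (insert i S)) l t x ^ (2 * k) :=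
    fun i _ => (even_two_mul k).pow_nonneg _
  rcases Nat.le_one_iff_eq_zero_or_eq_one.1 (T.card_fresh_le_one x t) with h | h
  · rw [queriedIncr, Finset.card_eq_zero.1 h, Finset.sum_empty, zero_pow (by omega)]
    exact Finset.sum_nonneg h0
  · obtain ⟨i, hi⟩ := Finset.card_eq_one.1 h
    have hx : ((x i : ℤ) : ℝ) ^ 2 = 1 := by
      rcases Int.units_eq_one_or (x i) with h | h <;> simp [h]
    rw [queriedIncr, hi, Finset.sum_singleton, mul_pow, pow_mul, hx, one_pow, one_mul]
    exact Finset.single_le_sum h0 (Finset.mem_univ i)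

end DecisionTree

/-! ### Moment inequalities -/

theorem Nat.choose_two_mul_le (k j : ℕ) :
    (2 * k).choose (2 * j) ≤ k.choose j * (2 * k) ^ j := by
  induction j with
  | zero => simp
  | succ j ih =>
    have h1 := Nat.choose_succ_right_eq (2 * k) (2 * j)
    have h2 := Nat.choose_succ_right_eq (2 * k) (2 * j + 1)
    have h3 := Nat.choose_succ_right_eq k j
    have h4 : (2 * k).choose (2 * j + 2) * (2 * j + 2) * (2 * j + 1)
        = (2 * k).choose (2 * j) * (2 * k - 2 * j) * (2 * k - (2 * j + 1)) := by
      rw [show 2 * j + 2 = 2 * j + 1 + 1 by ring, h2, ← h1]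
      ring
    have h5 : 2 * k - 2 * j = 2 * (k - j) := by omega
    have h6 : 2 * k - (2 * j + 1) ≤ 2 * k := Nat.sub_le _ _
    -- Compare the ratios of consecutive terms on both sides, with denominators cleared.
    refine Nat.le_of_mul_le_mul_right ?_ (show 0 < (2 * j + 2) * (2 * j + 1) by positivity)
    calc (2 * k).choose (2 * (j + 1)) * ((2 * j + 2) * (2 * j + 1))
        = (2 * k).choose (2 * j) * (2 * (k - j)) * (2 * k - (2 * j + 1)) := by
          rw [← h5, ← h4]; ring_nf
      _ ≤ (k.choose j * (2 * k) ^ j) * (2 * (k - j)) * (2 * k) := by gcongr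
      _ = (k.choose j * (k - j)) * (2 * (2 * k) ^ (j + 1)) := by ring
      _ = k.choose (j + 1) * (j + 1) * (2 * (2 * k) ^ (j + 1)) * 1 := by rw [h3]; ring
      _ ≤ k.choose (j + 1) * (j + 1) * (2 * (2 * k) ^ (j + 1)) * (2 * j + 1) := by
          gcongr; omega
      _ = _ := by ring

theorem Finset.sum_range_two_mul_add_one {M : Type*} [AddCommMonoid M] {f : ℕ → M}
    (hf : ∀ j, f (2 * j + 1) = 0) (k : ℕ) :
    ∑ n ∈ Finset.range (2 * k + 1), f n = ∑ j ∈ Finset.range (k + 1), f (2 * j) := by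
  induction k with
  | zero => simp
  | succ k ih =>
    rw [show 2 * (k + 1) + 1 = 2 * k + 1 + 1 + 1 by ring, Finset.sum_range_succ,
      Finset.sum_range_succ, ih, hf, add_zero, Finset.sum_range_succ _ (k + 1)]
    rfl

/-- A two-point hypercontractive inequality for even exponents. -/
theorem add_pow_add_sub_pow_le (a b : ℝ) (k : ℕ) :
    (a + b) ^ (2 * k) + (a - b) ^ (2 * k) ≤ 2 * (a ^ 2 + 2 * k * b ^ 2) ^ k := by
  have h : (a + b) ^ (2 * k) + (a - b) ^ (2 * k) = ∑ n ∈ Finset.range (2 * k + 1),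
      (b ^ n + (-b) ^ n) * a ^ (2 * k - n) * (2 * k).choose n := by
    rw [add_comm a b, show a - b = -b + a by ring, add_pow, add_pow, ← Finset.sum_add_distrib]
    exact Finset.sum_congr rfl fun n _ => by ring
  rw [h, Finset.sum_range_two_mul_add_one fun j => by
    rw [Odd.neg_pow (odd_two_mul_add_one j)]; ring, add_comm (a ^ 2), add_pow, Finset.mul_sum]
  refine Finset.sum_le_sum fun j _ => ?_
  have hc : ((2 * k).choose (2 * j) : ℝ) ≤ k.choose j * (2 * k) ^ j := by
    exact_mod_cast Nat.choose_two_mul_le k j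
  rw [(even_two_mul j).neg_pow, ← Nat.mul_sub, pow_mul b, pow_mul a]
  calc ((b ^ 2) ^ j + (b ^ 2) ^ j) * (a ^ 2) ^ (k - j) * (2 * k).choose (2 * j)
      ≤ ((b ^ 2) ^ j + (b ^ 2) ^ j) * (a ^ 2) ^ (k - j) * (k.choose j * (2 * k) ^ j) := by
        gcongr
    _ = _ := by rw [mul_pow _ (b ^ 2)]; ring

/-- Minkowski's inequality in normalized L^k. Applied to squares, it makes squared L^{2k} norms add
up along the martingale. -/
theorem sum_add_pow_le {ι : Type*} (s : Finset ι) {u v : ι → ℝ} {k : ℕ} (hk : k ≠ 0)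
    {A B : ℝ} (hu : ∀ x, 0 ≤ u x) (hv : ∀ x, 0 ≤ v x) (hA : 0 ≤ A) (hB : 0 ≤ B)
    (hAu : ∑ x ∈ s, u x ^ k ≤ A ^ k * s.card) (hBv : ∑ x ∈ s, v x ^ k ≤ B ^ k * s.card) :
    ∑ x ∈ s, (u x + v x) ^ k ≤ (A + B) ^ k * s.card := by
  have hk1 : (1 : ℝ) ≤ k := by exact_mod_cast Nat.one_le_iff_ne_zero.2 hk
  have hk0 : (k : ℝ) ≠ 0 := by positivity
  have key := Real.Lp_add_le_of_nonneg s hk1 (fun i _ => hu i) (fun i _ => hv i)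
  simp only [Real.rpow_natCast] at key
  have aux : ∀ {C D : ℝ}, 0 ≤ C → 0 ≤ D → D ≤ C ^ k * s.card →
      D ^ (1 / (k : ℝ)) ≤ C * (s.card : ℝ) ^ (1 / (k : ℝ)) := by
    intro C D hC hD h
    refine (Real.rpow_le_rpow hD h (by positivity)).trans_eq ?_
    rw [Real.mul_rpow (by positivity) (by positivity), one_div, Real.pow_rpow_inv_natCast hC hk]
  have h1 := key.trans (add_le_add (aux hA (Finset.sum_nonneg fun i _ => pow_nonneg (hu i) k) hAu)
    (aux hB (Finset.sum_nonneg fun i _ => pow_nonneg (hv i) k) hBv))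
  have h2 : 0 ≤ ∑ x ∈ s, (u x + v x) ^ k :=
    Finset.sum_nonneg fun i _ => pow_nonneg (add_nonneg (hu i) (hv i)) k
  have h3 := pow_le_pow_left₀ (Real.rpow_nonneg h2 _) h1 k
  rwa [← add_mul, mul_pow, one_div, Real.rpow_inv_natCast_pow h2 hk,
    Real.rpow_inv_natCast_pow (Nat.cast_nonneg _) hk] at h3

theorem sum_le_of_sum_pow_le {ι : Type*} (s : Finset ι) {u : ι → ℝ} {k : ℕ} (hk : k ≠ 0)
    {A : ℝ} (hu : ∀ x, 0 ≤ u x) (hA : 0 ≤ A) (h : ∑ x ∈ s, u x ^ k ≤ A ^ k * s.card) :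
    ∑ x ∈ s, u x ≤ A * s.card := by
  obtain ⟨n, rfl⟩ := Nat.exists_eq_succ_of_ne_zero hk
  rcases s.eq_empty_or_nonempty with rfl | hs
  · simp
  have hc : (0 : ℝ) < s.card := by exact_mod_cast hs.card_pos
  have h1 := (pow_sum_div_card_le_sum_pow (s := s) (f := u) (fun i _ => hu i) n).trans h
  rw [div_le_iff₀ (by positivity)] at h1
  refine le_of_pow_le_pow_left₀ hk (by positivity) (h1.trans_eq ?_)
  rw [Nat.succ_eq_add_one]
  ring

/-! ### Moments of the martingale -/

namespace DecisionTree

variable {m : ℕ}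

theorem sum_queriedSum_pow_le (T : DecisionTree m) (a : Finset (Fin m) → ℝ) (l : ℕ) {k : ℕ}
    (hk : k ≠ 0) {B : ℝ} (hB : 0 ≤ B) (t : ℕ)
    (h : ∀ s < t, ∑ x, T.queriedIncr a l s x ^ (2 * k) ≤ B ^ k * Fintype.card (Fin m → ℤˣ)) :
    ∑ x, T.queriedSum a (l + 1) t x ^ (2 * k)
      ≤ (t * (2 * k * B)) ^ k * Fintype.card (Fin m → ℤˣ) := by
  induction t with
  | zero => simp [queriedSum_zero_right, hk]
  | succ t ih =>
    have ih := ih fun s hs => h s (hs.trans t.lt_succ_self)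
    have hB' := h t t.lt_succ_self
    -- Reindexing by the flip changes the sign of the increment, so the two-point inequality applies
    -- to the average of both forms.
    have e1 : ∑ x, T.queriedSum a (l + 1) (t + 1) x ^ (2 * k)
        = ∑ x, (T.queriedSum a (l + 1) t x - T.queriedIncr a l t x) ^ (2 * k) := by
      rw [← Equiv.sum_comp (T.flip_involutive t).toPerm]
      refine Finset.sum_congr rfl fun x _ => ?_
      rw [Function.Involutive.coe_toPerm, queriedSum_succ, queriedSum_flip, queriedIncr_flip,
        sub_eq_add_neg]
    have e2 : ∑ x, T.queriedSum a (l + 1) (t + 1) x ^ (2 * k)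
        ≤ ∑ x, (T.queriedSum a (l + 1) t x ^ 2 + 2 * k * T.queriedIncr a l t x ^ 2) ^ k := by
      refine le_of_mul_le_mul_left ?_ (two_pos : (0 : ℝ) < 2)
      rw [two_mul]
      nth_rw 2 [e1]
      rw [← Finset.sum_add_distrib, Finset.mul_sum]
      refine Finset.sum_le_sum fun x _ => ?_
      rw [queriedSum_succ]
      exact add_pow_add_sub_pow_le _ _ k
    refine e2.trans ?_
    rw [show ((t + 1 : ℕ) : ℝ) * (2 * k * B) = t * (2 * k * B) + 2 * k * B by push_cast; ring]
    refine sum_add_pow_le Finset.univ hk (fun x => by positivity) (fun x => by positivity)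
      (by positivity) (by positivity) ?_ ?_
    · simpa only [pow_mul, Finset.card_univ] using ih
    · simp only [mul_pow _ _ k, ← Finset.mul_sum, mul_assoc] at hB' ⊢
      simp only [pow_mul] at hB'
      rw [Finset.card_univ]
      gcongr

theorem sum_queriedIncr_pow_le (T : DecisionTree m) (a : Finset (Fin m) → ℝ) (l t : ℕ) {k : ℕ}
    (hk : k ≠ 0) (hm : (m : ℝ) ≤ Real.exp k) {K : ℝ} (hK : 0 ≤ K)
    (h : ∀ i, ∑ x, T.queriedSum (fun S => a (insert i S)) l t x ^ (2 * k)
      ≤ K ^ k * Fintype.card (Fin m → ℤˣ)) :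
    ∑ x, T.queriedIncr a l t x ^ (2 * k)
      ≤ (Real.exp 1 * K) ^ k * Fintype.card (Fin m → ℤˣ) := by
  refine (Finset.sum_le_sum fun x _ => T.queriedIncr_pow_le a l t hk x).trans ?_
  rw [Finset.sum_comm]
  refine (Finset.sum_le_sum fun i _ => h i).trans ?_
  rw [Finset.sum_const, Finset.card_univ, Fintype.card_fin, nsmul_eq_mul, mul_pow, ← Real.exp_nat_mul,
    mul_one, ← mul_assoc]
  gcongr

theorem sum_queriedSum_pow_le_pow (T : DecisionTree m) {d k : ℕ} (hk : k ≠ 0)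
    (hm : (m : ℝ) ≤ Real.exp k) (l : ℕ) {a : Finset (Fin m) → ℝ} (ha : ∀ S, |a S| ≤ 1) {t : ℕ}
    (ht : t ≤ d) :
    ∑ x, T.queriedSum a l t x ^ (2 * k)
      ≤ ((2 * k * Real.exp 1 * d) ^ l) ^ k * Fintype.card (Fin m → ℤˣ) := by
  induction l generalizing a t with
  | zero =>
    have h1 : (a ∅ ^ 2) ^ k ≤ 1 := pow_le_one₀ (sq_nonneg _) ((sq_le_one_iff_abs_le_one _).2 (ha ∅))
    simp only [queriedSum_zero_left, Finset.sum_const, pow_mul, nsmul_eq_mul, Finset.card_univ,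
      pow_zero, one_pow, one_mul]
    exact mul_le_of_le_one_right (Nat.cast_nonneg _) h1
  | succ l ih =>
    refine (T.sum_queriedSum_pow_le a l hk
      (B := Real.exp 1 * (2 * k * Real.exp 1 * d) ^ l) (by positivity) t fun s hs =>
        T.sum_queriedIncr_pow_le a l s hk hm (by positivity) fun i =>
          ih (fun S => ha _) (hs.le.trans ht)).trans ?_
    have ht' : (t : ℝ) ≤ d := by exact_mod_cast ht
    rw [show (2 * k * Real.exp 1 * d) ^ (l + 1)
      = d * (2 * k * (Real.exp 1 * (2 * k * Real.exp 1 * d) ^ l)) by ring]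
    gcongr

/-- Lower degrees use exponent `2 * k` to handle the choice of variable; the top degree uses
exponent 2, so its factor is free of `k`. -/
theorem sum_abs_queriedSum_le (T : DecisionTree m) {d k : ℕ} (hk : k ≠ 0)
    (hm : (m : ℝ) ≤ Real.exp k) (l : ℕ) {a : Finset (Fin m) → ℝ} (ha : ∀ S, |a S| ≤ 1) :
    ∑ x, |T.queriedSum a (l + 1) d x|
      ≤ √(2 * Real.exp 1 * d * (2 * k * Real.exp 1 * d) ^ l) * Fintype.card (Fin m → ℤˣ) := by
  have h1 := T.sum_queriedSum_pow_le a l one_ne_zero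
    (B := Real.exp 1 * (2 * k * Real.exp 1 * d) ^ l) (by positivity) d fun s hs => by
      have h := T.sum_queriedIncr_pow_le a l s hk hm (by positivity) fun i =>
        T.sum_queriedSum_pow_le_pow hk hm l (fun S => ha _) hs.le
      simp only [pow_mul] at h
      simpa using sum_le_of_sum_pow_le Finset.univ hk (fun x => sq_nonneg _) (by positivity) h
  have h2 := sq_sum_le_card_mul_sum_sq (s := Finset.univ)
    (f := fun x => |T.queriedSum a (l + 1) d x|)
  simp only [mul_one, pow_one, sq_abs, Finset.card_univ] at h1 h2
  refine le_of_sq_le_sq ?_ (by positivity)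
  rw [mul_pow, Real.sq_sqrt (by positivity)]
  refine h2.trans ((mul_le_mul_of_nonneg_left h1 (Nat.cast_nonneg _)).trans_eq ?_)
  push_cast
  ring

/-! ### Level bound for the uniform distribution -/

/-- The indicator function of the accepted inputs. -/
noncomputable def indicator (T : DecisionTree m) (x : Fin m → ℤˣ) : ℝ :=
  if T.eval x = true then 1 else 0

theorem abs_indicator_le_one (T : DecisionTree m) (x : Fin m → ℤˣ) : |T.indicator x| ≤ 1 := by
  rw [indicator]; split_ifs <;> simp

/-- If `S` is not fully queried, flipping its least unqueried variable keeps the run and negates the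
monomial. The run is unchanged, so the same variable is chosen again and the flip is an involution.
-/
theorem sum_indicator_mul_prod (T : DecisionTree m) {d : ℕ} (hd : T.depth ≤ d)
    (S : Finset (Fin m)) :
    ∑ x, T.indicator x * ∏ i ∈ S, ((x i : ℤ) : ℝ)
      = ∑ x, if S ⊆ T.queried x d then T.indicator x * ∏ i ∈ S, ((x i : ℤ) : ℝ) else 0 := by
  rw [← Finset.sum_filter, ← Finset.sum_filter_add_sum_filter_not _ (fun x => S ⊆ T.queried x d),
    add_eq_left]
  have hne : ∀ x ∈ Finset.univ.filter fun x => ¬S ⊆ T.queried x d, (S \ T.queried x d).Nonempty :=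
    fun x hx => Finset.sdiff_nonempty.2 (Finset.mem_filter.1 hx).2
  let g (x : Fin m → ℤˣ) (hx : x ∈ Finset.univ.filter fun x => ¬S ⊆ T.queried x d) :
      Fin m → ℤˣ :=
    Function.update x ((S \ T.queried x d).min' (hne x hx))
      (-x ((S \ T.queried x d).min' (hne x hx)))
  have hmin : ∀ x hx, (S \ T.queried x d).min' (hne x hx) ∈ S \ T.queried x d :=
    fun x hx => Finset.min'_mem _ _
  have hg : ∀ x hx, ∀ i ∈ T.queried x d, g x hx i = x i := fun x hx i hi =>
    Function.update_of_ne (ne_of_mem_of_not_mem hi (Finset.mem_sdiff.1 (hmin x hx)).2) _ _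
  have hq : ∀ x hx, T.queried (g x hx) d = T.queried x d := fun x hx =>
    (T.after_queried_congr (hg x hx)).2
  have hmem : ∀ x hx, g x hx ∈ Finset.univ.filter fun x => ¬S ⊆ T.queried x d := fun x hx => by
    rw [Finset.mem_filter, hq x hx]
    exact ⟨Finset.mem_univ _, (Finset.mem_filter.1 hx).2⟩
  refine Finset.sum_involution g (fun x hx => ?_) (fun x hx _ h => ?_) hmem (fun x hx => ?_)
  · have hS := (Finset.mem_sdiff.1 (hmin x hx)).1
    have h : ∏ i ∈ S.erase ((S \ T.queried x d).min' (hne x hx)), ((g x hx i : ℤ) : ℝ)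
        = ∏ i ∈ S.erase ((S \ T.queried x d).min' (hne x hx)), ((x i : ℤ) : ℝ) :=
      Finset.prod_congr rfl fun i hi => by
        simp only [g, Function.update_of_ne (Finset.ne_of_mem_erase hi)]
    rw [indicator, indicator, T.eval_congr hd (hg x hx), ← mul_add,
      ← Finset.mul_prod_erase _ _ hS, ← Finset.mul_prod_erase S (fun i => ((g x hx i : ℤ) : ℝ)) hS,
      h]
    simp [g]
  · have := congrFun h ((S \ T.queried x d).min' (hne x hx))
    simp only [g, Function.update_self] at this
    rcases Int.units_eq_one_or (x ((S \ T.queried x d).min' (hne x hx))) with h' | h' <;>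
      rw [h'] at this <;> exact absurd this (by decide)
  · have h : (S \ T.queried (g x hx) d).min' (hne _ (hmem x hx))
        = (S \ T.queried x d).min' (hne x hx) := by
      simp only [hq x hx]
    change Function.update (g x hx) _ _ = x
    rw [h]
    simp [g]

/-- The level-`l` bound with respect to the uniform distribution, in dual form. -/
theorem sum_mul_sum_indicator_le (T : DecisionTree m) {d k : ℕ} (hd : T.depth ≤ d) (hk : k ≠ 0)
    (hm : (m : ℝ) ≤ Real.exp k) (l : ℕ) {a : Finset (Fin m) → ℝ} (ha : ∀ S, |a S| ≤ 1) :
    ∑ S ∈ Finset.univ.powersetCard (l + 1),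
        a S * ∑ x, T.indicator x * ∏ i ∈ S, ((x i : ℤ) : ℝ)
      ≤ √(2 * Real.exp 1 * d * (2 * k * Real.exp 1 * d) ^ l) * Fintype.card (Fin m → ℤˣ) := by
  refine le_trans ?_ (T.sum_abs_queriedSum_le hk hm l ha)
  simp only [T.sum_indicator_mul_prod hd, Finset.mul_sum]
  rw [Finset.sum_comm]
  refine Finset.sum_le_sum fun x _ => ?_
  have h : ∑ S ∈ Finset.univ.powersetCard (l + 1), a S *
      (if S ⊆ T.queried x d then T.indicator x * ∏ i ∈ S, ((x i : ℤ) : ℝ) else 0)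
      = T.indicator x * T.queriedSum a (l + 1) d x := by
    rw [queriedSum, Finset.mul_sum]
    simp only [mul_ite, mul_zero]
    rw [← Finset.sum_filter]
    refine Finset.sum_congr ?_ fun S _ => by ring
    ext S
    simp [Finset.mem_powersetCard, and_comm]
  rw [h]
  refine (le_abs_self _).trans ?_
  rw [abs_mul]
  exact mul_le_of_le_one_left (abs_nonneg _) (T.abs_indicator_le_one x)

end DecisionTree

/-! ### Random restrictions -/

namespace DecisionTree

variable {m : ℕ}

/-- The tree in which the variables fixed by the restriction `ρ` are not queried any more. -/
def restrict (ρ : Fin m → Option ℤˣ) : DecisionTree m → DecisionTree m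
  | leaf b => leaf b
  | query i neg pos =>
    match ρ i with
    | none => query i (neg.restrict ρ) (pos.restrict ρ)
    | some s => if s = 1 then pos.restrict ρ else neg.restrict ρ

theorem eval_restrict (ρ : Fin m → Option ℤˣ) (T : DecisionTree m) (x : Fin m → ℤˣ) :
    (T.restrict ρ).eval x = T.eval fun i => (ρ i).getD (x i) := by
  induction T with
  | leaf b => rfl
  | query i neg pos ihn ihp =>
    rw [restrict]
    cases h : ρ i with
    | none => simp [eval, h, ihn, ihp]
    | some s => by_cases hs : s = 1 <;> simp [eval, h, hs, ihn, ihp]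

theorem depth_restrict_le (ρ : Fin m → Option ℤˣ) (T : DecisionTree m) :
    (T.restrict ρ).depth ≤ T.depth := by
  induction T with
  | leaf b => rfl
  | query i neg pos ihn ihp =>
    rw [restrict]
    cases h : ρ i with
    | none => simp only [depth]; omega
    | some s => by_cases hs : s = 1 <;> simp only [hs, depth, if_true, if_false] <;> omega

end DecisionTree

section Restriction

variable {m : ℕ}

/-- The probability of the restriction `o` of one variable that leaves it free with probability
`1 / 2` and otherwise fixes it to a random sign of mean `2 * μ`. -/
noncomputable def restrictionWeight (μ : ℝ) : Option ℤˣ → ℝ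
  | none => 1 / 2
  | some s => (1 + 2 * μ * ((s : ℤ) : ℝ)) / 4

theorem restrictionWeight_nonneg {μ : ℝ} (hμ : μ ∈ Set.Icc (-(1 / 2) : ℝ) (1 / 2))
    (o : Option ℤˣ) : 0 ≤ restrictionWeight μ o := by
  obtain ⟨h1, h2⟩ := hμ
  cases o with
  | none => norm_num [restrictionWeight]
  | some s => rcases Int.units_eq_one_or s with rfl | rfl <;> simp [restrictionWeight] <;> linarith

theorem sum_intUnits {M : Type*} [AddCommMonoid M] (f : ℤˣ → M) : ∑ s, f s = f 1 + f (-1) := by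
  rw [show (Finset.univ : Finset ℤˣ) = {1, -1} by decide, Finset.sum_pair (by decide)]

theorem sum_restrictionWeight (μ : ℝ) : ∑ o, restrictionWeight μ o = 1 := by
  rw [Fintype.sum_option, sum_intUnits]
  simp only [restrictionWeight]
  push_cast
  ring

theorem sum_prod_restrictionWeight (μ : Fin m → ℝ) :
    ∑ ρ : Fin m → Option ℤˣ, ∏ i, restrictionWeight (μ i) (ρ i) = 1 := by
  rw [← Fintype.prod_sum fun i => restrictionWeight (μ i)]
  exact Finset.prod_eq_one fun i _ => sum_restrictionWeight (μ i)

theorem sum_restrictionWeight_mul_ite (μ : ℝ) (s : ℤˣ) :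
    ∑ o, ∑ u : ℤˣ, restrictionWeight μ o * (if o.getD u = s then 1 else 0)
      = 2 * if s = 1 then (1 + μ) / 2 else (1 - μ) / 2 := by
  simp only [Fintype.sum_option, sum_intUnits, restrictionWeight, Option.getD]
  rcases Int.units_eq_one_or s with rfl | rfl <;> simp <;> ring

/-- Only the free case survives the factor `u`. With σ = √(1 - μ²), both sides equal sσ. -/
theorem sum_restrictionWeight_mul_ite_mul {μ : ℝ} (hμ : 0 < 1 - μ ^ 2) (s : ℤˣ) :
    2 * √(1 - μ ^ 2) *
        ∑ o, ∑ u : ℤˣ, restrictionWeight μ o * ((if o.getD u = s then 1 else 0) * ((u : ℤ) : ℝ))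
      = 2 * ((if s = 1 then (1 + μ) / 2 else (1 - μ) / 2)
        * ((((s : ℤ) : ℝ) - μ) / √(1 - μ ^ 2))) := by
  have h0 : √(1 - μ ^ 2) ≠ 0 := (Real.sqrt_pos.2 hμ).ne'
  have h1 : √(1 - μ ^ 2) ^ 2 = 1 - μ ^ 2 := Real.sq_sqrt hμ.le
  simp only [Fintype.sum_option, sum_intUnits, restrictionWeight, Option.getD]
  rcases Int.units_eq_one_or s with rfl | rfl <;> simp <;> field_simp <;> rw [h1] <;> ring

/-- Both sides factor over the coordinates, which leaves the two one-variable identities, for `i ∈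
S` and `i ∉ S`. -/
theorem card_mul_biasedMass_mul_biasedCharacter {μ : Fin m → ℝ} (hμ : ∀ i, 0 < 1 - μ i ^ 2)
    (S : Finset (Fin m)) (x : Fin m → ℤˣ) :
    Fintype.card (Fin m → ℤˣ) * (biasedMass μ x * biasedCharacter μ S x)
      = (∏ i ∈ S, 2 * √(1 - μ i ^ 2)) * ∑ ρ : Fin m → Option ℤˣ,
        (∏ i, restrictionWeight (μ i) (ρ i)) * ∑ y : Fin m → ℤˣ,
          (if (fun i => (ρ i).getD (y i)) = x then 1 else 0) * ∏ i ∈ S, ((y i : ℤ) : ℝ) := by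
  have hS : ∀ f : Fin m → ℝ, ∏ i ∈ S, f i = ∏ i, if i ∈ S then f i else 1 := fun f => by
    rw [← Finset.prod_filter]; simp
  have hcard : (Fintype.card (Fin m → ℤˣ) : ℝ) = ∏ _i : Fin m, 2 := by simp
  have hite : ∀ ρ : Fin m → Option ℤˣ, ∀ y : Fin m → ℤˣ,
      (if (fun i => (ρ i).getD (y i)) = x then 1 else 0 : ℝ)
        = ∏ i, if (ρ i).getD (y i) = x i then 1 else 0 := fun ρ y => by
    rw [Finset.prod_ite_zero]; simp [funext_iff]
  have hsum : ∑ ρ : Fin m → Option ℤˣ, (∏ i, restrictionWeight (μ i) (ρ i)) *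
      ∑ y : Fin m → ℤˣ, (if (fun i => (ρ i).getD (y i)) = x then 1 else 0) *
        ∏ i ∈ S, ((y i : ℤ) : ℝ)
      = ∏ i, ∑ o, ∑ u : ℤˣ, restrictionWeight (μ i) o * ((if o.getD u = x i then 1 else 0) *
        if i ∈ S then ((u : ℤ) : ℝ) else 1) := by
    simp only [hite, hS, Fintype.prod_sum, Finset.prod_mul_distrib, Finset.mul_sum]
  rw [hsum, biasedMass, biasedCharacter, hS, hS, ← Finset.prod_mul_distrib,
    ← Finset.prod_mul_distrib, hcard, ← Finset.prod_mul_distrib]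
  refine Finset.prod_congr rfl fun i _ => ?_
  by_cases hi : i ∈ S
  · simp only [hi, if_true]
    exact (sum_restrictionWeight_mul_ite_mul (hμ i) (x i)).symm
  · simp only [hi, if_false, mul_one, one_mul]
    exact (sum_restrictionWeight_mul_ite (μ i) (x i)).symm

theorem card_mul_biasedFourierCoeff {μ : Fin m → ℝ} (hμ : ∀ i, 0 < 1 - μ i ^ 2)
    (f : (Fin m → ℤˣ) → ℝ) (S : Finset (Fin m)) :
    Fintype.card (Fin m → ℤˣ) * biasedFourierCoeff μ f S
      = (∏ i ∈ S, 2 * √(1 - μ i ^ 2)) * ∑ ρ : Fin m → Option ℤˣ,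
        (∏ i, restrictionWeight (μ i) (ρ i)) * ∑ y : Fin m → ℤˣ,
          f (fun i => (ρ i).getD (y i)) * ∏ i ∈ S, ((y i : ℤ) : ℝ) := by
  have h : ∀ (ρ : Fin m → Option ℤˣ) (y : Fin m → ℤˣ), f (fun i => (ρ i).getD (y i))
      = ∑ x, f x * if (fun i => (ρ i).getD (y i)) = x then 1 else 0 := fun ρ y => by simp
  have h' : ∀ x, (Fintype.card (Fin m → ℤˣ) : ℝ) * (biasedMass μ x * (f x * biasedCharacter μ S x))
      = f x * (Fintype.card (Fin m → ℤˣ) * (biasedMass μ x * biasedCharacter μ S x)) :=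
    fun x => by ring
  rw [biasedFourierCoeff, Finset.mul_sum]
  simp only [h', card_mul_biasedMass_mul_biasedCharacter hμ, h, Finset.sum_mul, Finset.mul_sum]
  rw [Finset.sum_comm]
  refine Finset.sum_congr rfl fun ρ _ => ?_
  rw [Finset.sum_comm]
  refine Finset.sum_congr rfl fun y _ => Finset.sum_congr rfl fun x _ => by ring

end Restriction

/-! ### Level bound for biased distributions and randomized trees -/

/-- The level-`l` bound with respect to a biased distribution, in dual form. -/
theorem DecisionTree.sum_mul_biasedFourierCoeff_le {m : ℕ} (T : DecisionTree m) {d k : ℕ}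
    (hd : T.depth ≤ d) (hk : k ≠ 0) (hm : (m : ℝ) ≤ Real.exp k) (l : ℕ) {μ : Fin m → ℝ}
    (hμ : ∀ i, μ i ∈ Set.Icc (-(1 / 2) : ℝ) (1 / 2))
    {a : Finset (Fin m) → ℝ} (ha : ∀ S, |a S| ≤ 1) :
    ∑ S ∈ Finset.univ.powersetCard (l + 1), a S * biasedFourierCoeff μ T.indicator S
      ≤ 2 ^ (l + 1) * √(2 * Real.exp 1 * d * (2 * k * Real.exp 1 * d) ^ l) := by
  set B := √(2 * Real.exp 1 * d * (2 * k * Real.exp 1 * d) ^ l)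
  have hμ' : ∀ i, 0 < 1 - μ i ^ 2 := fun i => by nlinarith [(hμ i).1, (hμ i).2]
  have hN : (0 : ℝ) < Fintype.card (Fin m → ℤˣ) := by exact_mod_cast Fintype.card_pos
  -- The factors √(1 - μ_i²) are absorbed into the coefficients, so the uniform bound is needed
  -- beyond signs.
  have ha' : ∀ S, |a S * ∏ i ∈ S, √(1 - μ i ^ 2)| ≤ 1 := fun S => by
    rw [abs_mul, Finset.abs_prod]
    refine mul_le_one₀ (ha S) (Finset.prod_nonneg fun _ _ => abs_nonneg _)
      (Finset.prod_le_one (fun _ _ => abs_nonneg _) fun i _ => ?_)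
    rw [abs_of_nonneg (Real.sqrt_nonneg _), Real.sqrt_le_one]
    linarith [sq_nonneg (μ i)]
  have hind : ∀ (ρ : Fin m → Option ℤˣ) (y : Fin m → ℤˣ),
      T.indicator (fun i => (ρ i).getD (y i)) = (T.restrict ρ).indicator y := fun ρ y => by
    rw [indicator, indicator, eval_restrict]
  refine le_of_mul_le_mul_left ?_ hN
  calc Fintype.card (Fin m → ℤˣ) * ∑ S ∈ Finset.univ.powersetCard (l + 1),
        a S * biasedFourierCoeff μ T.indicator S
      = ∑ S ∈ Finset.univ.powersetCard (l + 1),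
          a S * (Fintype.card (Fin m → ℤˣ) * biasedFourierCoeff μ T.indicator S) := by
        rw [Finset.mul_sum]; exact Finset.sum_congr rfl fun S _ => by ring
    _ = ∑ S ∈ Finset.univ.powersetCard (l + 1), ∑ ρ : Fin m → Option ℤˣ,
          2 ^ (l + 1) * ((∏ i, restrictionWeight (μ i) (ρ i)) *
            ((a S * ∏ i ∈ S, √(1 - μ i ^ 2)) * ∑ y : Fin m → ℤˣ,
              (T.restrict ρ).indicator y * ∏ i ∈ S, ((y i : ℤ) : ℝ))) := by
        refine Finset.sum_congr rfl fun S hS => ?_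
        rw [card_mul_biasedFourierCoeff hμ', Finset.prod_mul_distrib, Finset.prod_const,
          (Finset.mem_powersetCard.1 hS).2, Finset.mul_sum, Finset.mul_sum]
        simp only [hind]
        exact Finset.sum_congr rfl fun ρ _ => by ring
    _ = ∑ ρ : Fin m → Option ℤˣ, 2 ^ (l + 1) * ((∏ i, restrictionWeight (μ i) (ρ i)) *
          ∑ S ∈ Finset.univ.powersetCard (l + 1), (a S * ∏ i ∈ S, √(1 - μ i ^ 2)) *
            ∑ y : Fin m → ℤˣ, (T.restrict ρ).indicator y * ∏ i ∈ S, ((y i : ℤ) : ℝ)) := by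
        rw [Finset.sum_comm]
        simp only [← Finset.mul_sum]
    _ ≤ ∑ ρ : Fin m → Option ℤˣ, 2 ^ (l + 1) * ((∏ i, restrictionWeight (μ i) (ρ i)) *
          (B * Fintype.card (Fin m → ℤˣ))) := by
        gcongr with ρ
        · exact Finset.prod_nonneg fun i _ => restrictionWeight_nonneg (hμ i) _
        · exact (T.restrict ρ).sum_mul_sum_indicator_le ((T.depth_restrict_le ρ).trans hd) hk hm l
            ha'
    _ = _ := by
        rw [← Finset.mul_sum, ← Finset.sum_mul, sum_prod_restrictionWeight]
        ring

theorem PMF.hasSum_toReal {α : Type*} (p : PMF α) : HasSum (fun a => (p a).toReal) 1 := by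
  have h := (ENNReal.hasSum_toReal (f := p) (by rw [p.tsum_coe]; exact ENNReal.one_ne_top))
  rwa [← ENNReal.tsum_toReal_eq p.apply_ne_top, p.tsum_coe, ENNReal.toReal_one] at h

theorem RandomizedDecisionTree.hasSum_acceptProb {m d : ℕ} (R : RandomizedDecisionTree m d)
    (x : Fin m → ℤˣ) :
    HasSum (fun T => (R.law T).toReal * T.indicator x) (R.acceptProb x) := by
  have h : ∀ T, (R.law T).toReal * T.indicator x
      = ({T | T.eval x = true}.indicator R.law T).toReal := fun T => by
    by_cases hT : T.eval x = true <;> simp [DecisionTree.indicator, hT]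
  have hle : ∀ T, {T : DecisionTree m | T.eval x = true}.indicator R.law T ≤ R.law T :=
    Set.indicator_le_self _ _
  have htop : ∑' T, {T : DecisionTree m | T.eval x = true}.indicator R.law T ≠ ⊤ :=
    ne_top_of_le_ne_top R.law.tsum_coe_ne_top (ENNReal.tsum_le_tsum hle)
  simp only [h]
  rw [acceptProb, PMF.toOuterMeasure_apply, ENNReal.tsum_toReal_eq fun T =>
    ne_top_of_le_ne_top (R.law.apply_ne_top T) (hle T)]
  exact ENNReal.hasSum_toReal htop

theorem RandomizedDecisionTree.biasedFourierWeight_le {m d : ℕ} (R : RandomizedDecisionTree m d)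
    {k : ℕ} (hk : k ≠ 0) (hm : (m : ℝ) ≤ Real.exp k) (l : ℕ) {μ : Fin m → ℝ}
    (hμ : ∀ i, μ i ∈ Set.Icc (-(1 / 2) : ℝ) (1 / 2)) :
    biasedFourierWeight μ (l + 1) R.acceptProb
      ≤ 2 ^ (l + 1) * √(2 * Real.exp 1 * d * (2 * k * Real.exp 1 * d) ^ l) := by
  -- The signs come from the mixture and are the same for every tree, so the weight is linear in the
  -- tree.
  let a : Finset (Fin m) → ℝ := fun S => SignType.sign (biasedFourierCoeff μ R.acceptProb S)
  have ha : ∀ S, |a S| ≤ 1 := fun S => by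
    simp only [a]
    cases SignType.sign (biasedFourierCoeff μ R.acceptProb S) <;> simp
  have h1 : HasSum (fun T => (R.law T).toReal * ∑ S ∈ Finset.univ.powersetCard (l + 1),
      a S * biasedFourierCoeff μ T.indicator S)
      (biasedFourierWeight μ (l + 1) R.acceptProb) := by
    have h2 : biasedFourierWeight μ (l + 1) R.acceptProb
        = ∑ S ∈ Finset.univ.powersetCard (l + 1), a S * biasedFourierCoeff μ R.acceptProb S :=
      Finset.sum_congr rfl fun S _ => (sign_mul_self _).symm
    simp only [h2, biasedFourierCoeff, Finset.mul_sum]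
    refine hasSum_sum fun S _ => hasSum_sum fun x _ => ?_
    have h3 := (R.hasSum_acceptProb x).mul_left (a S * biasedMass μ x * biasedCharacter μ S x)
    rw [show a S * (biasedMass μ x * (R.acceptProb x * biasedCharacter μ S x))
      = a S * biasedMass μ x * biasedCharacter μ S x * R.acceptProb x by ring]
    exact h3.congr_fun fun T => by ring
  have h4 := R.law.hasSum_toReal.mul_right
    (2 ^ (l + 1) * √(2 * Real.exp 1 * d * (2 * k * Real.exp 1 * d) ^ l))
  rw [one_mul] at h4
  refine hasSum_le (fun T => ?_) h1 h4
  by_cases hT : R.law T = 0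
  · simp [hT]
  · exact mul_le_mul_of_nonneg_left (T.sum_mul_biasedFourierCoeff_le
      (R.depth_le T ((PMF.mem_support_iff _ _).2 hT)) hk hm l hμ ha) ENNReal.toReal_nonneg

theorem mainTheorem7 :
    ∃ c : ℝ, 0 < c ∧
      ∀ (m d l : ℕ), 1 ≤ m → 1 ≤ l → l ≤ d →
        ∀ (R : RandomizedDecisionTree m d) (μ : Fin m → ℝ),
          (∀ i, μ i ∈ Set.Icc (-(1 / 2) : ℝ) (1 / 2)) →
            biasedFourierWeight μ l R.acceptProb ≤
              Real.sqrt ((c * (d : ℝ)) ^ l * Real.log (m : ℝ) ^ (l - 1)) := by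
  -- 24 = 8 · 3: the 8 collects 2² from the restriction and 2 from the moment bound, the 3 comes
  -- from k ≤ 3 log m.
  refine ⟨24 * Real.exp 1, by positivity, ?_⟩
  intro m d l hm hl hld R μ hμ
  obtain ⟨l, rfl⟩ := Nat.exists_eq_add_of_le' hl
  rw [Nat.add_sub_cancel]
  have key : ∀ {k : ℕ}, k ≠ 0 → (m : ℝ) ≤ Real.exp k → (k : ℝ) ^ l ≤ (3 * Real.log m) ^ l →
      biasedFourierWeight μ (l + 1) R.acceptProb
        ≤ √((24 * Real.exp 1 * d) ^ (l + 1) * Real.log m ^ l) := fun {k} hk hmk hkl => by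
    refine (R.biasedFourierWeight_le hk hmk l hμ).trans (Real.le_sqrt_of_sq_le ?_)
    rw [mul_pow, Real.sq_sqrt (by positivity)]
    calc (2 ^ (l + 1)) ^ 2 * (2 * Real.exp 1 * d * (2 * k * Real.exp 1 * d) ^ l)
        = 8 * Real.exp 1 * d * (8 * Real.exp 1 * d) ^ l * k ^ l := by
          rw [← pow_mul, mul_comm (l + 1), pow_mul, pow_succ]
          simp only [mul_pow]
          rw [show (8 : ℝ) ^ l = 2 ^ l * (2 ^ 2) ^ l by rw [← mul_pow]; norm_num]
          ring
      _ ≤ (3 * (8 * Real.exp 1 * d)) * (8 * Real.exp 1 * d) ^ l * (3 * Real.log m) ^ l := by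
          refine mul_le_mul (mul_le_mul_of_nonneg_right ?_ (by positivity)) hkl (by positivity)
            (by positivity)
          linarith [show 0 ≤ 8 * Real.exp 1 * d by positivity]
      _ = (24 * Real.exp 1 * d) ^ (l + 1) * Real.log m ^ l := by
          rw [show 24 * Real.exp 1 * d = 3 * (8 * Real.exp 1 * d) by ring, pow_succ,
            mul_pow 3 (Real.log m), mul_pow 3]
          ring
  rcases hm.eq_or_lt with rfl | hm2
  -- For m = 1 the logarithm vanishes: level 1 has exponent 0, and higher levels are empty.
  · rcases Nat.eq_zero_or_pos l with rfl | hl0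
    · exact key one_ne_zero (by simp) (by simp)
    · have h : biasedFourierWeight μ (l + 1) R.acceptProb = 0 := by
        rw [biasedFourierWeight, Finset.powersetCard_eq_empty.2 (by simpa using hl0),
          Finset.sum_empty]
      rw [h]
      exact Real.sqrt_nonneg _
  -- This gives ⌈log m⌉ < log m + 1 ≤ 3 log m.
  · have hlog : 1 / 2 ≤ Real.log m := by
      have h2 : Real.log 2 ≤ Real.log m := Real.log_le_log two_pos (by exact_mod_cast hm2)
      linarith [Real.log_two_gt_d9]
    have hk : ⌈Real.log m⌉₊ ≠ 0 := (Nat.ceil_pos.2 (by linarith)).ne'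
    refine key hk ?_ ?_
    · rw [← Real.log_le_iff_le_exp (by positivity)]
      exact Nat.le_ceil _
    · gcongr
      linarith [Nat.ceil_lt_add_one (show 0 ≤ Real.log m by linarith)]
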